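/- Let $\mathbb T=\mathbb R/\mathbb Z$ with Lebesgue measure $dh$, let $\mathcal M(\mathbb T)$ be the space of finite signed Radon measures on $\mathbb T$, and let $\mathcal M^+(\mathbb T)$ be the set of its nonnegative elements. Let $$U=\Big\{u\in L^2(\mathbb T):\int_{\mathbb T}u\,dh=0\Big\},\qquad \widetilde V=\{u\in U:\ u\in W^{1,2}(\mathbb T),\ u_{hh}\in\mathcal M(\mathbb T)\},\qquad \|u\|_{\widetilde V}=\|u_{hh}\|_{\mathcal M(\mathbb T)},$$ where derivatives in $h$ are distributional and $U$ carries the inner product $\langle\cdot,\cdot\rangle$ of $L^2(\mathbb T)$. For $u\in\widetilde V$ let $u_{hh}=\eta_u+\nu_u$ be the Lebesgue decomposition, with $\eta_u\in L^1(\mathbb T)$ the absolutely continuous part and $\nu_u$ singular. Fix $c_0>0$ and $C\ge 2c_0$. Put $\Phi(x)=\frac12x^{-2}$ for $x>0$ and $\Phi(x)=+\infty$ for $x\le 0$, and for $u\in\widetilde V$ $$\phi(u)=\begin{cases}\int_{\mathbb T}\Phi(\eta_u+c_0)\,dh & \text{if } u_{hh}+c_0\in\mathcal M^+(\mathbb T),\\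 +\infty&\text{otherwise,}\end{cases}\qquad \psi(u)=\begin{cases}0&\text{if }\|u\|_{\widetilde V}\le C,\\+\infty&\text{otherwise.}\end{cases}$$ For $u\in\widetilde V$ let $Bu$ be the set of all $\xi\in U$ such that $(\phi+\psi)(v)\ge(\phi+\psi)(u)+\langle\xi,v-u\rangle$ for all $v\in\widetilde V$, and let $D(B)$ be the set of all $u\in\widetilde V$ with $Bu\neq\emptyset$. **Theorem 3.1.** Let $T>0$ and $w^0\in D(B)$. Let $w\in L^\infty(0,T;\widetilde V)\cap C^0([0,T];U)$ with $w_t\in L^\infty(0,T;U)$ be the variational inequality solution with initial datum $w^0$, that is, $w(0)=w^0$ and, for a.e. $t\in[0,T]$, $$\langle w_t(t),v-w(t)\rangle+(\phi+\psi)(v)-(\phi+\psi)(w(t))\ge0\qquad\text{for all }v\in\widetilde V.$$ Then $w$ is a strong solution. That is, with $\eta(t)=\eta_{w(t)}$: 1. for a.e. $t\in[0,T]$ one has $\eta(t)+c_0>0$ a.e. on $\mathbb T$, $(\eta(t)+c_0)^{-3}\in L^1(\mathbb T)$ and $((\eta(t)+c_0)^{-3})_{hh}\in U$, and $$w_t=\big((\eta+c_0)^{-3}\big)_{hh}\qquad\text{for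 a.e. }(t,h)\in[0,T]\times\mathbb T;$$ 2. $\big((\eta+c_0)^{-3}\big)_{hh}\in L^\infty(0,T;U)$; 3. with $E(t)=\frac12\int_{\mathbb T}\big[((\eta(t)+c_0)^{-3})_{hh}\big]^2\,dh$, where $\eta(0)=\eta_{w^0}$, one has $E(0)<\infty$ and $E(t)\le E(0)$ for a.e. $t\in[0,T]$. -/

import Mathlib

open MeasureTheory Set
open scoped ENNReal ContDiff InnerProductSpace

noncomputable section

namespace ThinFilm

/-- The torus `ℝ / ℤ` with Lebesgue measure `volume` (of total mass one). One-periodic functions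
and measures on the line are functions and measures on `𝕋`. -/
abbrev 𝕋 : Type := UnitAddCircle

/-- The space `U` of square integrable one-periodic functions with mean value zero, with the
norm and the inner product of `L²(𝕋)`. -/
def U : Submodule ℝ (Lp ℝ 2 (volume : Measure 𝕋)) where
  carrier := {f | ∫ h, f h = 0}
  add_mem' {f g} hf hg := by
    have hi (k : Lp ℝ 2 (volume : Measure 𝕋)) : Integrable k volume :=
      (Lp.memLp k).integrable (by norm_num)
    simp only [mem_ofPred_eq] at hf hg ⊢
    rw [integral_congr_ae (Lp.coeFn_add f g)]
    simp only [Pi.add_apply]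
    rw [integral_add (hi f) (hi g), hf, hg, add_zero]
  zero_mem' := by
    simp only [mem_ofPred_eq]
    rw [integral_congr_ae (Lp.coeFn_zero ℝ 2 volume)]
    simp
  smul_mem' c f hf := by
    simp only [mem_ofPred_eq] at hf ⊢
    rw [integral_congr_ae (Lp.coeFn_smul c f)]
    simp only [Pi.smul_apply, smul_eq_mul]
    rw [integral_const_mul, hf, mul_zero]

/-- `U` is complete, so that Bochner integrals of `U`-valued functions are meaningful. -/
instance : CompleteSpace U := by
  have hU : IsClosed (U : Set (Lp ℝ 2 (volume : Measure 𝕋))) := by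
    have he : (U : Set (Lp ℝ 2 (volume : Measure 𝕋))) =
        {f | ⟪indicatorConstLp 2 MeasurableSet.univ (measure_ne_top volume univ) (1 : ℝ), f⟫_ℝ
          = 0} := by
      ext f
      rw [mem_ofPred_eq, L2.inner_indicatorConstLp_one, setIntegral_univ]
      rfl
    rw [he]
    exact isClosed_eq (continuous_const.inner continuous_id) continuous_const
  exact hU.completeSpace_coe

/-! ### Smooth functions and distributional derivatives on the torus -/

/-- Smooth functions on the torus, the test functions. -/
def IsSmooth (f : 𝕋 → ℝ) : Prop := ContDiff ℝ ∞ fun x : ℝ => f (x : 𝕋)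

/-- The classical `n`-th derivative of a function on the torus. -/
def D (n : ℕ) (f : 𝕋 → ℝ) (h : 𝕋) : ℝ := iteratedDeriv n (fun x : ℝ => f (h + (x : 𝕋))) 0

/-- `u ∈ W^{1,2}(𝕋)`: the distributional derivative of `u` is a square integrable function. -/
def InW12 (u : U) : Prop :=
  ∃ g : Lp ℝ 2 (volume : Measure 𝕋), ∀ f : 𝕋 → ℝ, IsSmooth f →
    ∫ h, u.1 h * D 1 f h = -∫ h, g h * f h

/-- `u_hh = μ` in the sense of distributions on `𝕋`, with `μ` a finite signed (Radon) measure. -/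
def HasMeasureHH (u : U) (μ : SignedMeasure 𝕋) : Prop :=
  ∀ f : 𝕋 → ℝ, IsSmooth f → ∫ h, u.1 h * D 2 f h = ∫ᵛ h, f h ∂•μ

/-- `F_hh = g` in the sense of distributions on `𝕋`, for integrable `F` and square integrable
`g`. -/
def HasL2HH (F : 𝕋 → ℝ) (g : U) : Prop :=
  Integrable F volume ∧
    ∀ f : 𝕋 → ℝ, IsSmooth f → ∫ h, F h * D 2 f h = ∫ h, g.1 h * f h

/-! ### The space `Ṽ` and the functionals -/

/-- The space `Ṽ` of functions in `W^{1,2}` with mean value zero whose second distributional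
derivative is a finite signed measure. -/
def V : Set U := {u | InW12 u ∧ ∃ μ, HasMeasureHH u μ}

open Classical in
/-- The measure `u_hh`, for `u ∈ Ṽ` (it is unique; the value `0` outside `Ṽ` is not used). -/
def hh (u : U) : SignedMeasure 𝕋 := if H : ∃ μ, HasMeasureHH u μ then H.choose else 0

/-- The norm of `Ṽ`, the total mass of `u_hh`. -/
def normV (u : U) : ℝ≥0∞ := (hh u).totalVariation univ

/-- The density `η` of the part of `u_hh` that is absolutely continuous with respect to Lebesgue
measure (the Lebesgue decomposition is `u_hh = η + ν`, with `ν` singular). -/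
def eta (u : U) : 𝕋 → ℝ := (hh u).rnDeriv volume

/-- `Φ(x) = x⁻² / 2` for `x > 0`, and `+∞` for `x ≤ 0`. -/
def Phi (x : ℝ) : ℝ≥0∞ := if x ≤ 0 then ⊤ else ENNReal.ofReal ((x ^ 2)⁻¹ / 2)

open Classical in
/-- `φ(u) = ∫ Φ(η + c₀) dh` if `u ∈ Ṽ` and `u_hh + c₀ ∈ M⁺(𝕋)`, and `+∞` otherwise. -/
def phi (c₀ : ℝ) (u : U) : ℝ≥0∞ :=
  if u ∈ V ∧ 0 ≤ hh u + c₀ • (volume : Measure 𝕋).toSignedMeasure then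
    ∫⁻ h, Phi (eta u h + c₀)
  else ⊤

open Classical in
/-- The indicator functional `ψ` of the ball of radius `C` of `Ṽ`. -/
def psi (C : ℝ) (u : U) : ℝ≥0∞ := if u ∈ V ∧ normV u ≤ ENNReal.ofReal C then 0 else ⊤

/-- The functional `φ + ψ`, with values in `(-∞, +∞]`. -/
def total (c₀ C : ℝ) (u : U) : EReal := ((phi c₀ u + psi C u : ℝ≥0∞) : EReal)

/-- The operator `B`: the elements of the sub-differential of `φ + ψ` on `Ṽ` that lie in `U`
(acting on `Ṽ ⊆ U` through the inner product of `U`). -/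
def B (c₀ C : ℝ) (u : U) : Set U :=
  {ξ | u ∈ V ∧ ∀ v ∈ V, total c₀ C u + ((⟪ξ, v - u⟫_ℝ : ℝ) : EReal) ≤ total c₀ C v}

/-- The domain of `B`. -/
def domB (c₀ C : ℝ) : Set U := {u | (B c₀ C u).Nonempty}

/-! ### The two notions of solution -/

/-- Lebesgue measure on the time interval `[0, T]`. -/
def time (T : ℝ) : Measure ℝ := volume.restrict (Icc 0 T)

/-- `w ∈ L^∞(0,T;Ṽ) ∩ C⁰([0,T];U)` and `w_t = wt ∈ L^∞(0,T;U)`. The time derivative is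
characterised by the fundamental theorem of calculus, with a Bochner integral in `U`. The
measurability of `w` as a `Ṽ`-valued map is the weak-* one, which follows from the continuity
of `w` in `U`. -/
structure IsRegular (T : ℝ) (w wt : ℝ → U) : Prop where
  bounded : ∃ M : ℝ, ∀ᵐ t ∂time T, w t ∈ V ∧ normV (w t) ≤ ENNReal.ofReal M
  continuousOn : ContinuousOn w (Icc 0 T)
  deriv_memLp : MemLp wt ⊤ (time T)
  deriv_eq : ∀ t ∈ Icc 0 T, w t = w 0 + ∫ s in (0 : ℝ)..t, wt s

/-- `w`, with time derivative `wt`, is a variational inequality solution on `[0, T]`: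
`⟨w_t, v - w⟩ + (φ + ψ)(v) - (φ + ψ)(w) ≥ 0` for a.e. `t` and all `v ∈ Ṽ`. The last term stands on
the other side, so that no difference of infinities occurs. -/
structure IsVISolution (c₀ C T : ℝ) (w wt : ℝ → U) : Prop extends IsRegular T w wt where
  inequality : ∀ᵐ t ∂time T, ∀ v ∈ V,
    total c₀ C (w t) ≤ ((⟪wt t, v - w t⟫_ℝ : ℝ) : EReal) + total c₀ C v

/-- `g = ((η + c₀)⁻³)_hh`, where `η` is the absolutely continuous part of `u_hh`, `u ∈ Ṽ`. It is
required that `η + c₀` is positive almost everywhere, so that the power is meaningful. -/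
def IsFluxHH (c₀ : ℝ) (u : U) (g : U) : Prop :=
  u ∈ V ∧ (∀ᵐ h : 𝕋, 0 < eta u h + c₀) ∧ HasL2HH (fun h => ((eta u h + c₀) ^ 3)⁻¹) g

/-- The energy `E(u) = ½ ∫ [((η + c₀)⁻³)_hh]² dh`; it is `+∞` if `((η + c₀)⁻³)_hh` is not defined
as an element of `L²`. (There is at most one `g` to take the infimum over.) -/
def energy (c₀ : ℝ) (u : U) : ℝ≥0∞ :=
  ⨅ (g : U) (_ : IsFluxHH c₀ u g), ENNReal.ofReal (1 / 2 * ∫ h, g.1 h ^ 2)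

/-- `w`, with time derivative `wt`, is a strong solution on `[0, T]`. Here `F` is the function
`((η + c₀)⁻³)_hh` of time and space. -/
structure IsStrongSolution (c₀ T : ℝ) (w wt : ℝ → U) : Prop extends IsRegular T w wt where
  equation : ∃ F : ℝ → U, (∀ᵐ t ∂time T, IsFluxHH c₀ (w t) (F t)) ∧
    (∀ᵐ p ∂(time T).prod (volume : Measure 𝕋), (wt p.1).1 p.2 = (F p.1).1 p.2) ∧
    MemLp F ⊤ (time T)
  energy_zero_lt_top : energy c₀ (w 0) < ⊤
  dissipation : ∀ᵐ t ∂time T, energy c₀ (w t) ≤ energy c₀ (w 0)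

end ThinFilm

end

open ThinFilm

namespace ThinFilm

/-! The variational inequality says that `-w_t ∈ B w` for almost every time, so the theorem reduces
to two facts about `B`.

Euler–Lagrange equation: if `ξ ∈ B u`, then `((η + c₀)⁻³)_hh = -ξ`. A distributional second
derivative has total charge zero, so `u_hh + c₀ ≥ 0` already forces `‖u‖ ≤ 2c₀ ≤ C` (`normV_le`) and
`ψ` never interferes. One may then vary `u` in both directions `±εv`, provided that `v_hh = σ` is
bounded and supported where `η + c₀ ≥ δ`; the singular part of `u_hh` is untouched. This gives `⟨ξ,
v⟩ + ∫ σ (η + c₀)⁻³ = 0` (`first_variation`). Writing `ξ = R_hh` with `R` continuous turns `⟨ξ, v⟩`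
into `∫ σ R`, so `(η + c₀)⁻³ + R` is constant on `{η + c₀ ≥ δ}` (`flux_const_of_le`). Letting `δ →
0` covers almost all of the torus, because finiteness of `φ` makes `η + c₀` positive a.e.
(`isFluxHH_of_mem_B`).

Monotonicity of `B`: it makes `‖w(t + s) - w(t)‖` nonincreasing in `t`, and `‖w(s) - w(0)‖ ≤ s‖ξ‖`
for every `ξ ∈ B(w⁰)`. Hence `‖w_t‖ ≤ ‖ξ‖` a.e. (`IsVISolution.norm_deriv_le`). By the first fact
the two sides are the square roots of `2E(t)` and `2E(0)`. -/

/-! ### Smooth test functions and uniqueness of distributional second derivatives. -/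

theorem IsSmooth.continuous {f : 𝕋 → ℝ} (hf : IsSmooth f) : Continuous f := by
  have hq : Topology.IsQuotientMap ((↑) : ℝ → 𝕋) := QuotientAddGroup.isQuotientMap_mk _
  exact hq.continuous_iff.2 (ContDiff.continuous hf)

theorem isSmooth_const (c : ℝ) : IsSmooth fun _ => c := contDiff_const

/-- A continuous function on the torus is bounded, hence integrable for every finite measure. -/
theorem integrable_of_continuous {f : 𝕋 → ℝ} (hf : Continuous f) (μ : Measure 𝕋)
    [IsFiniteMeasure μ] : Integrable f μ := by
  exact integrableOn_univ.1 (hf.continuousOn.integrableOn_compact isCompact_univ)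

/-- The algebra of smooth functions on the torus. -/
noncomputable def smoothFunctions : StarSubalgebra ℝ (BoundedContinuousFunction 𝕋 ℝ) where
  carrier := {g | IsSmooth g}
  mul_mem' hf hg := ContDiff.mul (𝕜 := ℝ) (n := ∞) hf hg
  add_mem' hf hg := ContDiff.add (𝕜 := ℝ) (n := ∞) hf hg
  algebraMap_mem' c := isSmooth_const c
  star_mem' hf := hf

theorem isSmooth_re_fourier : IsSmooth fun x => (fourier (T := 1) 1 x).re := by
  have : (fun x : ℝ => (fourier (T := 1) 1 (x : 𝕋)).re) = fun x => Real.cos (2 * Real.pi * x) := by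
    ext x
    rw [fourier_coe_apply, show (2 * Real.pi * Complex.I * (1 : ℤ) * x / (1 : ℝ) : ℂ)
      = ((2 * Real.pi * x : ℝ) : ℂ) * Complex.I by push_cast; ring, Complex.exp_ofReal_mul_I_re]
  rw [IsSmooth, this]
  fun_prop

theorem isSmooth_im_fourier : IsSmooth fun x => (fourier (T := 1) 1 x).im := by
  have : (fun x : ℝ => (fourier (T := 1) 1 (x : 𝕋)).im) = fun x => Real.sin (2 * Real.pi * x) := by
    ext x
    rw [fourier_coe_apply, show (2 * Real.pi * Complex.I * (1 : ℤ) * x / (1 : ℝ) : ℂ)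
      = ((2 * Real.pi * x : ℝ) : ℂ) * Complex.I by push_cast; ring, Complex.exp_ofReal_mul_I_im]
  rw [IsSmooth, this]
  fun_prop

/-- Smooth functions separate the points of the torus. -/
theorem exists_isSmooth_ne {x y : 𝕋} (hxy : x ≠ y) : ∃ f, IsSmooth f ∧ f x ≠ f y := by
  by_contra! h
  -- The first Fourier mode embeds the torus in the circle, so its real and imaginary parts together
  -- separate points.
  refine hxy ((AddCircle.injective_toCircle (T := 1) one_ne_zero) (Circle.ext ?_))
  have hre := h _ isSmooth_re_fourier
  have him := h _ isSmooth_im_fourier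
  simp only [fourier_one] at hre him
  exact Complex.ext hre him

/-- Finite measures on the torus are determined by the integrals of smooth functions. -/
theorem measure_ext_of_isSmooth {μ ν : Measure 𝕋} [IsFiniteMeasure μ] [IsFiniteMeasure ν]
    (h : ∀ f, IsSmooth f → ∫ x, f x ∂μ = ∫ x, f x ∂ν) : μ = ν := by
  refine ext_of_forall_mem_subalgebra_integral_eq_of_pseudoEMetric_complete_countable
    (𝕜 := ℝ) (A := smoothFunctions) ?_ fun g hg => h g hg
  intro x y hxy
  obtain ⟨f, hf, hne⟩ := exists_isSmooth_ne hxy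
  exact ⟨f, ⟨_, ⟨BoundedContinuousFunction.mkOfCompact ⟨f, hf.continuous⟩, hf, rfl⟩, rfl⟩, hne⟩

theorem integral_toSignedMeasure_sub {f : 𝕋 → ℝ} (hf : Continuous f) (p n : Measure 𝕋)
    [IsFiniteMeasure p] [IsFiniteMeasure n] :
    ∫ᵛ x, f x ∂•(p.toSignedMeasure - n.toSignedMeasure) = ∫ x, f x ∂p - ∫ x, f x ∂n := by
  have hL : (ContinuousLinearMap.lsmul ℝ ℝ : ℝ →L[ℝ] ℝ →L[ℝ] ℝ) =
      (ContinuousLinearMap.lsmul ℝ ℝ).flip := by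
    ext; simp
  have hi (q : Measure 𝕋) [IsFiniteMeasure q] : q.toSignedMeasure.Integrable f := by
    rw [VectorMeasure.Integrable, Measure.variation_toSignedMeasure]
    exact integrable_of_continuous hf q
  rw [VectorMeasure.integral_sub_vectorMeasure (hi p) (hi n), hL,
    VectorMeasure.integral_toSignedMeasure, VectorMeasure.integral_toSignedMeasure]

theorem integral_signedMeasure {f : 𝕋 → ℝ} (hf : Continuous f) (μ : SignedMeasure 𝕋) :
    ∫ᵛ x, f x ∂•μ = ∫ x, f x ∂μ.toJordanDecomposition.posPart -
      ∫ x, f x ∂μ.toJordanDecomposition.negPart := by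
  conv_lhs => rw [← μ.toSignedMeasure_toJordanDecomposition]
  exact integral_toSignedMeasure_sub hf _ _

/-- Finite signed measures on the torus are determined by the integrals of smooth functions. -/
theorem signedMeasure_ext_of_isSmooth {μ ν : SignedMeasure 𝕋}
    (h : ∀ f : 𝕋 → ℝ, IsSmooth f → ∫ᵛ x, f x ∂•μ = ∫ᵛ x, f x ∂•ν) : μ = ν := by
  -- Moving the negative parts across leaves an identity between positive measures, to which
  -- `measure_ext_of_isSmooth` applies.
  have key : μ.toJordanDecomposition.posPart + ν.toJordanDecomposition.negPart =
      ν.toJordanDecomposition.posPart + μ.toJordanDecomposition.negPart := by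
    refine measure_ext_of_isSmooth fun f hf => ?_
    have hi (q : Measure 𝕋) [IsFiniteMeasure q] := integrable_of_continuous hf.continuous q
    rw [integral_add_measure (hi _) (hi _), integral_add_measure (hi _) (hi _)]
    have := h f hf
    rw [integral_signedMeasure hf.continuous, integral_signedMeasure hf.continuous] at this
    linarith
  ext s hs
  rw [μ.apply_eq_posPart_real_sub_negPart_real hs, ν.apply_eq_posPart_real_sub_negPart_real hs]
  have := congrArg (fun q : Measure 𝕋 => q.real s) key
  rw [measureReal_add_apply, measureReal_add_apply] at this
  linarith

theorem integral_withDensity {f g : 𝕋 → ℝ} (hf : Continuous f) (hg : Integrable g) :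
    ∫ᵛ x, f x ∂•((volume : Measure 𝕋).withDensityᵥ g) = ∫ x, g x * f x := by
  have := isFiniteMeasure_withDensity_ofReal hg.2
  have := isFiniteMeasure_withDensity_ofReal hg.neg.2
  obtain ⟨K, hK⟩ := isCompact_univ.exists_bound_of_continuousOn hf.continuousOn
  have hm {k : 𝕋 → ℝ} (hk : Integrable k) : Integrable fun x => k x * f x := by
    simpa [mul_comm] using hk.bdd_mul (c := K) hf.aestronglyMeasurable
      (.of_forall fun x => hK x (mem_univ x))
  rw [withDensityᵥ_eq_withDensity_pos_part_sub_withDensity_neg_part hg,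
    integral_toSignedMeasure_sub hf]
  have h1 {k : 𝕋 → ℝ} (hk : Integrable k) :
      ∫ x, f x ∂(volume.withDensity fun x => ENNReal.ofReal (k x)) = ∫ x, max (k x) 0 * f x := by
    rw [integral_withDensity_eq_integral_toReal_smul₀ hk.1.aemeasurable.ennreal_ofReal (by simp)]
    simp [ENNReal.toReal_ofReal', smul_eq_mul]
  have hn : Integrable fun x => -g x := hg.neg
  rw [h1 hg, h1 hn, ← integral_sub (hm hg.pos_part) (hm hn.pos_part)]
  refine integral_congr_ae (.of_forall fun x => ?_)
  beta_reduce
  rw [← sub_mul]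
  congr 1
  rcases le_total (g x) 0 with h | h
  · rw [max_eq_right h, max_eq_left (by linarith)]; ring
  · rw [max_eq_left h, max_eq_right (by linarith)]; ring

theorem integral_add_signedMeasure {f : 𝕋 → ℝ} (hf : Continuous f) (μ ν : SignedMeasure 𝕋) :
    ∫ᵛ x, f x ∂•(μ + ν) = ∫ᵛ x, f x ∂•μ + ∫ᵛ x, f x ∂•ν := by
  have hi (q : SignedMeasure 𝕋) : q.Integrable f := by
    rw [VectorMeasure.Integrable, ← SignedMeasure.totalVariation_eq_variation]
    exact integrable_of_continuous hf _
  exact VectorMeasure.integral_add_vectorMeasure (hi μ) (hi ν)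

theorem HasMeasureHH.unique {u : U} {μ ν : SignedMeasure 𝕋} (hμ : HasMeasureHH u μ)
    (hν : HasMeasureHH u ν) : μ = ν :=
  signedMeasure_ext_of_isSmooth fun f hf => (hμ f hf).symm.trans (hν f hf)

/-- Uniqueness makes the choice in `hh` harmless: any measure that represents the second derivative
may be used to compute it. -/
theorem HasMeasureHH.hh_eq {u : U} {μ : SignedMeasure 𝕋} (hμ : HasMeasureHH u μ) : hh u = μ := by
  have H : ∃ μ, HasMeasureHH u μ := ⟨μ, hμ⟩
  rw [hh, dif_pos H]
  exact H.choose_spec.unique hμ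

theorem hasMeasureHH_hh {u : U} (hu : u ∈ V) : HasMeasureHH u (hh u) := by
  obtain ⟨μ, hμ⟩ := hu.2
  rwa [hμ.hh_eq]

theorem memLp_coe (g : U) : MemLp g.1 2 (volume : Measure 𝕋) := Lp.memLp g.1

theorem integrable_coe (g : U) : Integrable g.1 (volume : Measure 𝕋) :=
  (memLp_coe g).integrable (by norm_num)

theorem integral_coe (g : U) : ∫ h, g.1 h = 0 := g.2

theorem inner_eq_integral (f g : U) : ⟪f, g⟫_ℝ = ∫ h, f.1 h * g.1 h := by
  rw [Submodule.coe_inner, L2.inner_def]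
  simp [mul_comm]

/-- The second distributional derivative is unique as an element of `L²`. -/
theorem HasL2HH.unique {F : 𝕋 → ℝ} {g k : U} (hg : HasL2HH F g) (hk : HasL2HH F k) : g = k := by
  have : volume.withDensityᵥ g.1 = volume.withDensityᵥ (k.1 : 𝕋 → ℝ) := by
    refine signedMeasure_ext_of_isSmooth fun f hf => ?_
    rw [integral_withDensity hf.continuous (integrable_coe g),
      integral_withDensity hf.continuous (integrable_coe k), ← hg.2 f hf, ← hk.2 f hf]
  exact Subtype.ext (Lp.ext ((integrable_coe g).ae_eq_of_withDensityᵥ_eq (integrable_coe k) this))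

/-- The element of `U` represented by a square integrable function of mean value zero. -/
noncomputable def mkU (f : 𝕋 → ℝ) (hf : MemLp f 2 volume) (h0 : ∫ x, f x = 0) : U :=
  ⟨hf.toLp f, by
    change ∫ h, (hf.toLp f) h = 0
    rw [integral_congr_ae hf.coeFn_toLp, h0]⟩

theorem coe_mkU {f : 𝕋 → ℝ} (hf : MemLp f 2 volume) (h0 : ∫ x, f x = 0) :
    (mkU f hf h0).1 =ᵐ[volume] f := hf.coeFn_toLp

/-! ### Derivatives, primitives and integration by parts on the torus. -/

theorem D_coe (n : ℕ) (f : 𝕋 → ℝ) (x : ℝ) :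
    D n f (x : 𝕋) = iteratedDeriv n (fun y : ℝ => f (y : 𝕋)) x := by
  have := congrFun (iteratedDeriv_comp_const_add n (fun y : ℝ => f (y : 𝕋)) x) 0
  simpa [D] using this

theorem IsSmooth.D {f : 𝕋 → ℝ} (hf : IsSmooth f) (n : ℕ) : IsSmooth (ThinFilm.D n f) := by
  simp only [IsSmooth, D_coe]
  rw [iteratedDeriv_eq_iterate]
  exact ContDiff.iterate_deriv n hf

theorem D_two (f : 𝕋 → ℝ) : D 2 f = D 1 (D 1 f) := by
  ext x
  obtain ⟨x, rfl⟩ := QuotientAddGroup.mk_surjective x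
  rw [D_coe, D_coe]
  simp only [D_coe, iteratedDeriv_succ, iteratedDeriv_zero]

/-- `G` is a primitive of the integrable function `g` on the torus. -/
def IsPrimitive (G g : 𝕋 → ℝ) : Prop :=
  Integrable g ∧ ∀ x : ℝ, G (x : 𝕋) = G ((0 : ℝ) : 𝕋) + ∫ y in (0 : ℝ)..x, g (y : 𝕋)

theorem intervalIntegrable_coe {g : 𝕋 → ℝ} (hg : Integrable g) (a b : ℝ) :
    IntervalIntegrable (fun y : ℝ => g (y : 𝕋)) volume a b := by
  have hp : Function.Periodic (fun y : ℝ => g (y : 𝕋)) 1 := fun y => by simp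
  refine hp.intervalIntegrable₀ one_ne_zero ?_ a b
  rw [intervalIntegrable_iff_integrableOn_Ioc_of_le zero_le_one]
  have := (UnitAddCircle.measurePreserving_mk 0).integrable_comp_of_integrable hg
  rwa [zero_add] at this

theorem integral_torus (g : 𝕋 → ℝ) : ∫ x, g x = ∫ y in (0 : ℝ)..1, g (y : 𝕋) := by
  rw [← UnitAddCircle.intervalIntegral_preimage 0, zero_add]

theorem coe_one_eq : ((1 : ℝ) : 𝕋) = ((0 : ℝ) : 𝕋) := by simp

namespace IsPrimitive

variable {G g K k : 𝕋 → ℝ}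

theorem continuous (h : IsPrimitive G g) : Continuous G := by
  have hq : Topology.IsQuotientMap ((↑) : ℝ → 𝕋) := QuotientAddGroup.isQuotientMap_mk _
  refine hq.continuous_iff.2 ?_
  have : G ∘ ((↑) : ℝ → 𝕋) = fun x : ℝ => G ((0 : ℝ) : 𝕋) + ∫ y in (0 : ℝ)..x, g (y : 𝕋) :=
    funext h.2
  rw [this]
  exact continuous_const.add
    (intervalIntegral.continuous_primitive (intervalIntegrable_coe h.1) 0)

theorem integral_eq_zero (h : IsPrimitive G g) : ∫ x, g x = 0 := by
  have := h.2 1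
  rw [coe_one_eq] at this
  rw [integral_torus]
  linarith

theorem absolutelyContinuous (h : IsPrimitive G g) :
    AbsolutelyContinuousOnInterval (fun x : ℝ => G (x : 𝕋)) 0 1 := by
  have h1 : AbsolutelyContinuousOnInterval (fun _ : ℝ => G ((0 : ℝ) : 𝕋)) 0 1 :=
    (LipschitzWith.const _).lipschitzOnWith.absolutelyContinuousOnInterval
  have h2 := (intervalIntegrable_coe h.1 0 1).absolutelyContinuousOnInterval_intervalIntegral
    (c := 0) (by simp)
  rw [funext h.2]
  exact h1.add h2

theorem ae_deriv (h : IsPrimitive G g) :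
    ∀ᵐ x : ℝ, x ∈ uIcc (0 : ℝ) 1 → deriv (fun x : ℝ => G (x : 𝕋)) x = g (x : 𝕋) := by
  filter_upwards [(intervalIntegrable_coe h.1 0 1).ae_hasDerivAt_integral] with x hx hm
  rw [funext h.2]
  exact ((hx hm 0 (by simp)).const_add _).deriv

/-- Integration by parts on the torus. -/
theorem integral_mul (hG : IsPrimitive G g) (hK : IsPrimitive K k) :
    ∫ x, G x * k x = -∫ x, g x * K x := by
  have h := hG.absolutelyContinuous.integral_mul_deriv_eq_deriv_mul hK.absolutelyContinuous
  rw [integral_torus, integral_torus]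
  have h1 : ∫ y in (0 : ℝ)..1, G (y : 𝕋) * k (y : 𝕋) =
      ∫ y in (0 : ℝ)..1, G (y : 𝕋) * deriv (fun x : ℝ => K (x : 𝕋)) y := by
    refine intervalIntegral.integral_congr_ae ?_
    filter_upwards [hK.ae_deriv] with y hy hm
    rw [hy (uIoc_subset_uIcc hm)]
  have h2 : ∫ y in (0 : ℝ)..1, g (y : 𝕋) * K (y : 𝕋) =
      ∫ y in (0 : ℝ)..1, deriv (fun x : ℝ => G (x : 𝕋)) y * K (y : 𝕋) := by
    refine intervalIntegral.integral_congr_ae ?_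
    filter_upwards [hG.ae_deriv] with y hy hm
    rw [hy (uIoc_subset_uIcc hm)]
  -- The boundary terms cancel, since `0` and `1` are the same point of the torus.
  rw [h1, h2, h, coe_one_eq]
  ring

end IsPrimitive

/-- An integrable function of mean value zero on the torus has a primitive of mean value zero. -/
theorem exists_isPrimitive {g : 𝕋 → ℝ} (hg : Integrable g) (h0 : ∫ x, g x = 0) :
    ∃ G, IsPrimitive G g ∧ ∫ x, G x = 0 := by
  set P : ℝ → ℝ := fun x => ∫ y in (0 : ℝ)..x, g (y : 𝕋) with hP
  -- Mean value zero is exactly what lets the primitive descend to the torus.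
  have hper : Function.Periodic P 1 := by
    intro x
    have hp : Function.Periodic (fun y : ℝ => g (y : 𝕋)) 1 := fun y => by simp
    have := hp.intervalIntegral_add_eq_add 0 x fun a b => intervalIntegrable_coe hg a b
    simp only [hP, this]
    rw [zero_add, ← integral_torus, h0, add_zero]
  have hprim (c : ℝ) : IsPrimitive (fun x => hper.lift x - c) g := by
    refine ⟨hg, fun x => ?_⟩
    have h (y : ℝ) : hper.lift (y : 𝕋) = P y := rfl
    beta_reduce
    rw [h, h]
    simp only [hP, intervalIntegral.integral_same]
    ring
  refine ⟨_, hprim (∫ x, hper.lift x), ?_⟩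
  have hc : Continuous hper.lift := by simpa using (hprim 0).continuous
  rw [integral_sub (integrable_of_continuous hc _) (integrable_const _), integral_const, measureReal_def,
    UnitAddCircle.measure_univ]
  simp

theorem IsSmooth.isPrimitive {f : 𝕋 → ℝ} (hf : IsSmooth f) : IsPrimitive f (ThinFilm.D 1 f) := by
  refine ⟨integrable_of_continuous (hf.D 1).continuous _, fun x => ?_⟩
  simp only [D_coe, iteratedDeriv_one]
  rw [intervalIntegral.integral_deriv_eq_sub
    (fun y _ => (ContDiff.differentiable hf (by simp)).differentiableAt)
    ((ContDiff.continuous_deriv hf (by simp)).intervalIntegrable _ _)]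
  ring

/-! ### Potentials: solutions of `v_hh = g`. -/

theorem memLp_of_continuous {f : 𝕋 → ℝ} (hf : Continuous f) : MemLp f 2 volume := by
  obtain ⟨K, hK⟩ := isCompact_univ.exists_bound_of_continuousOn hf.continuousOn
  exact MemLp.of_bound hf.aestronglyMeasurable K (.of_forall fun x => hK x (mem_univ x))

theorem integral_mul_congr {f f' : 𝕋 → ℝ} (h : f =ᵐ[volume] f') (g : 𝕋 → ℝ) :
    ∫ x, f x * g x = ∫ x, f' x * g x :=
  integral_congr_ae (h.mono fun x hx => by simp only [hx])

/-- Solvability of `v_hh = g` on the torus, with a continuous solution. -/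
structure IsPotential (v : U) (S g : 𝕋 → ℝ) : Prop where
  ae_eq : v.1 =ᵐ[volume] S
  exists_isPrimitive : ∃ G, IsPrimitive S G ∧ IsPrimitive G g

theorem exists_isPotential {g : 𝕋 → ℝ} (hg : Integrable g) (h0 : ∫ x, g x = 0) :
    ∃ v S, IsPotential v S g := by
  obtain ⟨G, hG, hG0⟩ := exists_isPrimitive hg h0
  obtain ⟨S, hS, hS0⟩ := exists_isPrimitive (integrable_of_continuous hG.continuous _) hG0
  exact ⟨mkU S (memLp_of_continuous hS.continuous) hS0, S, coe_mkU _ _, G, hS, hG⟩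

namespace IsPotential

variable {v w : U} {S R g k : 𝕋 → ℝ}

theorem continuous (h : IsPotential v S g) : Continuous S := by
  obtain ⟨G, hS, -⟩ := h.exists_isPrimitive
  exact hS.continuous

theorem integrable (h : IsPotential v S g) : Integrable g := by
  obtain ⟨G, -, hG⟩ := h.exists_isPrimitive
  exact hG.1

theorem integral_mul_D (h : IsPotential v S g) {f : 𝕋 → ℝ} (hf : IsSmooth f) :
    ∫ x, S x * D 2 f x = ∫ x, g x * f x := by
  obtain ⟨G, hS, hG⟩ := h.exists_isPrimitive
  rw [D_two, hS.integral_mul (hf.D 1).isPrimitive, hG.integral_mul hf.isPrimitive, neg_neg]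

/-- Symmetry of the second derivative. It rewrites `⟨ξ, v⟩` as an integral against `v_hh`, which
puts it in the same form as the variation of `φ`. -/
theorem integral_mul (h : IsPotential v S g) (hw : IsPotential w R k) :
    ∫ x, S x * k x = ∫ x, g x * R x := by
  obtain ⟨G, hS, hG⟩ := h.exists_isPrimitive
  obtain ⟨K, hR, hK⟩ := hw.exists_isPrimitive
  rw [hS.integral_mul hK, hG.integral_mul hR, neg_neg]

theorem inW12 (h : IsPotential v S g) : InW12 v := by
  obtain ⟨G, hS, hG⟩ := h.exists_isPrimitive
  have hm := memLp_of_continuous hG.continuous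
  refine ⟨hm.toLp G, fun f hf => ?_⟩
  rw [integral_mul_congr h.ae_eq, integral_mul_congr hm.coeFn_toLp]
  exact hS.integral_mul hf.isPrimitive

theorem hasMeasureHH (h : IsPotential v S g) :
    HasMeasureHH v ((volume : Measure 𝕋).withDensityᵥ g) := by
  intro f hf
  rw [integral_withDensity hf.continuous h.integrable, integral_mul_congr h.ae_eq]
  exact h.integral_mul_D hf

end IsPotential

theorem integrable_mul_of_continuous {g f : 𝕋 → ℝ} (hg : Integrable g) (hf : Continuous f) :
    Integrable fun x => g x * f x := by
  obtain ⟨K, hK⟩ := isCompact_univ.exists_bound_of_continuousOn hf.continuousOn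
  simpa [mul_comm] using hg.bdd_mul (c := K) hf.aestronglyMeasurable
    (.of_forall fun x => hK x (mem_univ x))

theorem integral_coe_add_mul (u v : U) {f : 𝕋 → ℝ} (hf : Continuous f) :
    ∫ x, (u + v).1 x * f x = (∫ x, u.1 x * f x) + ∫ x, v.1 x * f x := by
  rw [← integral_add (integrable_mul_of_continuous (integrable_coe u) hf)
    (integrable_mul_of_continuous (integrable_coe v) hf)]
  refine integral_congr_ae ?_
  filter_upwards [Lp.coeFn_add u.1 v.1] with x hx
  have : (u + v).1 x = u.1 x + v.1 x := hx
  rw [this, add_mul]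

theorem InW12.add {u v : U} (hu : InW12 u) (hv : InW12 v) : InW12 (u + v) := by
  obtain ⟨a, ha⟩ := hu
  obtain ⟨b, hb⟩ := hv
  refine ⟨a + b, fun f hf => ?_⟩
  have hi (k : Lp ℝ 2 (volume : Measure 𝕋)) : Integrable k :=
    (Lp.memLp k).integrable (by norm_num)
  rw [integral_coe_add_mul u v (hf.D 1).continuous, ha f hf, hb f hf, ← neg_add,
    ← integral_add (integrable_mul_of_continuous (hi a) hf.continuous)
    (integrable_mul_of_continuous (hi b) hf.continuous)]
  congr 1
  refine integral_congr_ae ?_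
  filter_upwards [Lp.coeFn_add a b] with x hx
  rw [hx, Pi.add_apply, add_mul]

/-! ### Perturbation by a potential, and the constraint `u_hh + c₀ ≥ 0`. -/

section Perturbation

variable {u v : U} {S g : 𝕋 → ℝ}

theorem hasMeasureHH_add_potential (hu : u ∈ V) (hv : IsPotential v S g) :
    HasMeasureHH (u + v) (hh u + volume.withDensityᵥ g) := fun f hf => by
  rw [integral_coe_add_mul u v (hf.D 2).continuous, integral_add_signedMeasure hf.continuous,
    hasMeasureHH_hh hu f hf, hv.hasMeasureHH f hf]

theorem add_potential_mem_V (hu : u ∈ V) (hv : IsPotential v S g) : u + v ∈ V :=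
  ⟨hu.1.add hv.inW12, _, hasMeasureHH_add_potential hu hv⟩

theorem singularPart_add_eta (u : U) :
    (hh u).singularPart volume + volume.withDensityᵥ (eta u) = hh u :=
  SignedMeasure.singularPart_add_withDensity_rnDeriv_eq _ _

theorem measurable_eta (u : U) : Measurable (eta u) := SignedMeasure.measurable_rnDeriv _ _

theorem integrable_eta (u : U) : Integrable (eta u) := SignedMeasure.integrable_rnDeriv _ _

/-- A potential adds an absolutely continuous measure, so the singular part stays and uniqueness of
the Lebesgue decomposition identifies the new density. -/
theorem eta_add_potential (hu : u ∈ V) (hv : IsPotential v S g) :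
    eta (u + v) =ᵐ[volume] fun h => eta u h + g h := by
  refine (SignedMeasure.eq_rnDeriv ((hh u).singularPart volume) _
    ((integrable_eta u).add hv.integrable)
    (SignedMeasure.mutuallySingular_singularPart _ _) ?_).symm
  rw [(hasMeasureHH_add_potential hu hv).hh_eq, withDensityᵥ_add (integrable_eta u) hv.integrable,
    ← add_assoc, singularPart_add_eta]

theorem toSignedMeasure_smul_apply (c : ℝ) {i : Set 𝕋} (hi : MeasurableSet i) :
    (c • (volume : Measure 𝕋).toSignedMeasure) i = c * volume.real i := by
  simp [hi]

/-- The singular part of `u_hh` is nonnegative when `u_hh + c` is. -/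
theorem singularPart_nonneg {c : ℝ}
    (hp : 0 ≤ hh u + c • (volume : Measure 𝕋).toSignedMeasure) {i : Set 𝕋}
    (hi : MeasurableSet i) : 0 ≤ (hh u).singularPart volume i := by
  -- The singular part lives on `nᶜ`, which is Lebesgue null. Testing the constraint on `i ∩ nᶜ`
  -- therefore removes both the density and the constant.
  obtain ⟨n, hn, hn1, hn2⟩ := SignedMeasure.mutuallySingular_singularPart (hh u) volume
  have hvol : volume nᶜ = 0 := by
    simpa [hn.compl] using hn2 nᶜ subset_rfl
  have hz : volume (i ∩ nᶜ) = 0 := measure_mono_null inter_subset_right hvol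
  have h0 := (VectorMeasure.le_iff.1 hp) (i ∩ nᶜ) (hi.inter hn.compl)
  rw [_root_.add_apply, toSignedMeasure_smul_apply c (hi.inter hn.compl), measureReal_def,
    hz, ← singularPart_add_eta u, _root_.add_apply,
    withDensityᵥ_apply (integrable_eta u) (hi.inter hn.compl), Measure.restrict_eq_zero.2 hz] at h0
  have hs : (hh u).singularPart volume i = (hh u).singularPart volume (i ∩ nᶜ) := by
    conv_lhs => rw [← inter_union_compl i n]
    rw [VectorMeasure.of_union (disjoint_compl_right.mono inter_subset_right inter_subset_right)
      (hi.inter hn) (hi.inter hn.compl), hn1 _ inter_subset_right, zero_add]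
  rw [hs]
  simpa using h0

theorem add_potential_nonneg {c : ℝ} (hu : u ∈ V) (hv : IsPotential v S g)
    (hp : 0 ≤ hh u + c • (volume : Measure 𝕋).toSignedMeasure)
    (hg : ∀ᵐ h, 0 ≤ eta u h + g h + c) :
    0 ≤ hh (u + v) + c • (volume : Measure 𝕋).toSignedMeasure := by
  rw [(hasMeasureHH_add_potential hu hv).hh_eq]
  refine VectorMeasure.le_iff.2 fun i hi => ?_
  rw [_root_.add_apply, toSignedMeasure_smul_apply c hi, _root_.add_apply,
    ← singularPart_add_eta u, _root_.add_apply,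
    withDensityᵥ_apply (integrable_eta u) hi, withDensityᵥ_apply hv.integrable hi]
  have hs := singularPart_nonneg hp hi
  have h1 : 0 ≤ ∫ h in i, (eta u h + g h + c) :=
    setIntegral_nonneg_of_ae hg
  rw [integral_add (f := fun h => eta u h + g h)
    ((integrable_eta u).add hv.integrable).integrableOn
    (integrable_const c).integrableOn,
    integral_add (integrable_eta u).integrableOn hv.integrable.integrableOn] at h1
  simp only [integral_const, smul_eq_mul, measureReal_restrict_apply MeasurableSet.univ,
    univ_inter] at h1
  change (0 : ℝ) ≤ _
  linarith

theorem D_const (n : ℕ) (hn : n ≠ 0) (c : ℝ) : D n (fun _ => c) = 0 := by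
  ext x
  simp [D, iteratedDeriv_const, hn]

/-- A distributional second derivative has total charge zero. -/
theorem hh_univ (hu : u ∈ V) : hh u univ = 0 := by
  have h := hasMeasureHH_hh hu _ (isSmooth_const 1)
  rw [D_const 2 two_ne_zero, integral_signedMeasure continuous_const] at h
  rw [SignedMeasure.apply_eq_posPart_real_sub_negPart_real _ MeasurableSet.univ]
  simpa using h.symm

/-- The constraint `u_hh + c ≥ 0` bounds the norm of `u` by `2 c`. -/
theorem normV_le {c : ℝ} (hc : 0 ≤ c) (hu : u ∈ V)
    (hp : 0 ≤ hh u + c • (volume : Measure 𝕋).toSignedMeasure) :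
    normV u ≤ ENNReal.ofReal (2 * c) := by
  -- The negative part lives on `s`, where the constraint bounds its mass by `c * volume s ≤ c`.
  -- Total charge zero gives the positive part the same mass, hence the factor `2`.
  obtain ⟨s, hs, hs1, hs2⟩ := (hh u).toJordanDecomposition.mutuallySingular
  set p := (hh u).toJordanDecomposition.posPart with hp_def
  set n := (hh u).toJordanDecomposition.negPart with hn_def
  have h1 := (hh u).apply_eq_posPart_real_sub_negPart_real hs
  have h2 := (hh u).apply_eq_posPart_real_sub_negPart_real hs.compl
  have h3 : hh u s + hh u sᶜ = 0 := by
    rw [← VectorMeasure.of_union disjoint_compl_right hs hs.compl, union_compl_self, hh_univ hu]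
  have h4 := VectorMeasure.le_iff.1 hp s hs
  rw [_root_.add_apply, toSignedMeasure_smul_apply c hs] at h4
  change (0 : ℝ) ≤ _ at h4
  have h5 : volume.real s ≤ 1 := by
    refine (measureReal_mono (subset_univ s)).trans ?_
    simp [measureReal_def]
  rw [← hp_def, ← hn_def] at h1 h2
  have h6 : p.real s = 0 := by simp [measureReal_def, hs1]
  have h7 : n.real sᶜ = 0 := by simp [measureReal_def, hs2]
  have h8 : p.real univ = p.real sᶜ := by
    rw [← measureReal_add_measureReal_compl hs, h6, zero_add]
  have h9 : n.real univ = n.real s := by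
    rw [← measureReal_add_measureReal_compl hs, h7, add_zero]
  have h10 : (hh u).totalVariation.real univ ≤ 2 * c := by
    rw [SignedMeasure.totalVariation, measureReal_add_apply, ← hp_def, ← hn_def, h8, h9]
    have := mul_le_mul_of_nonneg_left h5 hc
    linarith
  rw [normV, ← ENNReal.ofReal_toReal (measure_ne_top (hh u).totalVariation univ)]
  exact ENNReal.ofReal_le_ofReal h10

/-- The effective domain condition of `φ`. -/
def Admissible (c₀ : ℝ) (u : U) : Prop :=
  u ∈ V ∧ 0 ≤ hh u + c₀ • (volume : Measure 𝕋).toSignedMeasure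

theorem Admissible.total_eq {c₀ C : ℝ} (hc : 0 ≤ c₀) (hC : 2 * c₀ ≤ C) (hu : Admissible c₀ u) :
    total c₀ C u = ((∫⁻ h, Phi (eta u h + c₀) : ℝ≥0∞) : EReal) := by
  rw [total, phi, psi, if_pos (show _ ∧ _ from hu),
    if_pos ⟨hu.1, (normV_le hc hu.1 hu.2).trans (ENNReal.ofReal_le_ofReal hC)⟩, add_zero]

theorem Phi_of_pos {x : ℝ} (hx : 0 < x) : Phi x = ENNReal.ofReal ((x ^ 2)⁻¹ / 2) := by
  rw [Phi, if_neg hx.not_ge]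

theorem measurable_Phi : Measurable Phi :=
  Measurable.ite measurableSet_Iic measurable_const (by fun_prop)

/-- The second order Taylor estimate for `Φ`, away from zero. -/
theorem Phi_add_le {δ x s : ℝ} (hδ : 0 < δ) (hx : δ ≤ x) (hs : |s| ≤ δ / 2) :
    Phi (x + s) ≤ ENNReal.ofReal ((x ^ 2)⁻¹ / 2 - s * (x ^ 3)⁻¹ + 8 * s ^ 2 / δ ^ 4) := by
  obtain ⟨hs1, hs2⟩ := abs_le.1 hs
  have hx0 : 0 < x := hδ.trans_le hx
  have hxs : 0 < x + s := by linarith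
  rw [Phi_of_pos hxs]
  refine ENNReal.ofReal_le_ofReal ?_
  have h1 : ((x + s) ^ 2)⁻¹ / 2 = (x ^ 2)⁻¹ / 2 - s * (x ^ 3)⁻¹ +
      s ^ 2 * (3 * x + 2 * s) / (2 * x ^ 3 * (x + s) ^ 2) := by
    field_simp
    ring
  rw [h1]
  refine add_le_add_right ?_ _
  -- Since `|s| ≤ δ / 2 ≤ x / 2`, both `3x + 2s ≤ 4x` and `x + s ≥ x / 2` hold.
  calc s ^ 2 * (3 * x + 2 * s) / (2 * x ^ 3 * (x + s) ^ 2)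
      ≤ s ^ 2 * (4 * x) / (2 * x ^ 3 * (x / 2) ^ 2) := by
        gcongr <;> linarith
    _ = 8 * s ^ 2 / x ^ 4 := by field_simp; ring
    _ ≤ 8 * s ^ 2 / δ ^ 4 := by gcongr

end Perturbation

/-! ### Finiteness of the functional and its first variation. -/

section FirstVariation

variable {c₀ C : ℝ} {u v ξ : U} {S g : 𝕋 → ℝ}

theorem IsPrimitive.const_mul {G g : 𝕋 → ℝ} (h : IsPrimitive G g) (c : ℝ) :
    IsPrimitive (fun x => c * G x) fun x => c * g x := by
  refine ⟨h.1.const_mul c, fun x => ?_⟩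
  beta_reduce
  rw [h.2 x, intervalIntegral.integral_const_mul, mul_add]

theorem IsPotential.smul (h : IsPotential v S g) (c : ℝ) :
    IsPotential (c • v) (fun x => c * S x) fun x => c * g x := by
  obtain ⟨G, hS, hG⟩ := h.exists_isPrimitive
  refine ⟨?_, _, hS.const_mul c, hG.const_mul c⟩
  filter_upwards [Lp.coeFn_smul c v.1, h.ae_eq] with x hx hx'
  have : (c • v).1 x = c * v.1 x := hx
  rw [this, hx']

theorem zero_admissible (hc : 0 < c₀) : Admissible c₀ 0 ∧ eta 0 =ᵐ[volume] 0 := by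
  have h0 : HasMeasureHH 0 0 := fun f hf => by
    have : ∀ᵐ x, (0 : U).1 x = 0 := Lp.coeFn_zero ℝ 2 volume
    rw [integral_mul_congr (f' := 0) this]
    simp
  have hV : (0 : U) ∈ V := by
    refine ⟨⟨0, fun f hf => ?_⟩, 0, h0⟩
    have : ∀ᵐ x, (0 : U).1 x = 0 := Lp.coeFn_zero ℝ 2 volume
    rw [integral_mul_congr (f' := 0) this,
      integral_mul_congr (f' := 0) (Lp.coeFn_zero ℝ 2 volume)]
    simp
  refine ⟨⟨hV, ?_⟩, ?_⟩
  · rw [h0.hh_eq, zero_add]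
    refine VectorMeasure.le_iff.2 fun i hi => ?_
    rw [toSignedMeasure_smul_apply c₀ hi]
    exact mul_nonneg hc.le measureReal_nonneg
  · refine (SignedMeasure.eq_rnDeriv (s := hh 0) (μ := volume) 0 0 (integrable_zero _ _ _)
      VectorMeasure.MutuallySingular.zero_left ?_).symm
    rw [h0.hh_eq]
    simp

theorem total_zero_lt_top (hc : 0 < c₀) (hC : 2 * c₀ ≤ C) : total c₀ C 0 < ⊤ := by
  obtain ⟨h0, he⟩ := zero_admissible hc
  rw [h0.total_eq hc.le hC]
  have : ∫⁻ h, Phi (eta 0 h + c₀) = ∫⁻ _ : 𝕋, Phi c₀ :=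
    lintegral_congr_ae (he.mono fun h hh => by simp [hh])
  rw [this, lintegral_const, Phi_of_pos hc, UnitAddCircle.measure_univ, mul_one,
    EReal.coe_ennreal_ofReal]
  exact EReal.coe_lt_top _

theorem total_eq_top_of_not_admissible (hu : ¬ Admissible c₀ u) : total c₀ C u = ⊤ := by
  rw [total, phi, if_neg (show ¬ (_ ∧ _) from hu), top_add, EReal.coe_ennreal_top]

/-- The functional is finite on the domain of the sub-differential. -/
theorem total_lt_top_of_mem_B (hc : 0 < c₀) (hC : 2 * c₀ ≤ C) (hξ : ξ ∈ B c₀ C u) :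
    total c₀ C u < ⊤ := by
  -- The competitor `v = 0` has finite energy because `c₀ > 0`.
  have h := (hξ.2 0 (zero_admissible hc).1.1).trans_lt (total_zero_lt_top hc hC)
  by_contra hne
  rw [not_lt_top_iff.1 hne, EReal.top_add_coe] at h
  exact lt_irrefl _ h

theorem admissible_of_mem_B (hc : 0 < c₀) (hC : 2 * c₀ ≤ C) (hξ : ξ ∈ B c₀ C u) :
    Admissible c₀ u := by
  by_contra h
  exact (total_lt_top_of_mem_B hc hC hξ).ne (total_eq_top_of_not_admissible h)

theorem lintegral_Phi_lt_top (hc : 0 < c₀) (hC : 2 * c₀ ≤ C) (hξ : ξ ∈ B c₀ C u) :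
    ∫⁻ h, Phi (eta u h + c₀) < ⊤ := by
  have h := total_lt_top_of_mem_B hc hC hξ
  rw [(admissible_of_mem_B hc hC hξ).total_eq hc.le hC] at h
  rw [lt_top_iff_ne_top] at h ⊢
  simpa using h

theorem ae_pos_of_lintegral_Phi {r : 𝕋 → ℝ} (hr : Measurable r)
    (hf : ∫⁻ h, Phi (r h) < ⊤) : ∀ᵐ h, 0 < r h := by
  filter_upwards [ae_lt_top (measurable_Phi.comp hr) hf.ne] with h hh
  by_contra hn
  simp [Phi, not_lt.1 hn] at hh

theorem integrable_inv_sq {r : 𝕋 → ℝ} (hr : Measurable r) (hf : ∫⁻ h, Phi (r h) < ⊤) :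
    Integrable fun h => (r h ^ 2)⁻¹ / 2 := by
  refine ⟨by fun_prop, ?_⟩
  rw [hasFiniteIntegral_iff_ofReal (.of_forall fun h => by positivity)]
  refine lt_of_eq_of_lt (lintegral_congr_ae ?_) hf
  filter_upwards [ae_pos_of_lintegral_Phi hr hf] with h hh
  rw [Phi_of_pos hh]

theorem lintegral_Phi_eq {r : 𝕋 → ℝ} (hr : Measurable r) (hf : ∫⁻ h, Phi (r h) < ⊤) :
    ∫⁻ h, Phi (r h) = ENNReal.ofReal (∫ h, (r h ^ 2)⁻¹ / 2) := by
  rw [ofReal_integral_eq_lintegral_ofReal (integrable_inv_sq hr hf)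
    (.of_forall fun h => by positivity)]
  refine lintegral_congr_ae ?_
  filter_upwards [ae_pos_of_lintegral_Phi hr hf] with h hh
  rw [Phi_of_pos hh]

theorem eq_zero_of_forall_mul_le {a L ε₀ : ℝ} (hε₀ : 0 < ε₀) (hL : 0 ≤ L)
    (h : ∀ ε : ℝ, |ε| ≤ ε₀ → ε * a ≤ L * ε ^ 2) : a = 0 := by
  by_contra ha
  set t : ℝ := min (ε₀ / |a|) (1 / (2 * (L + 1))) with ht
  have ha' : 0 < |a| := abs_pos.2 ha
  have ht0 : 0 < t := lt_min (by positivity) (by positivity)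
  have ht1 : t * |a| ≤ ε₀ := by
    rw [← le_div_iff₀ ha']; exact min_le_left _ _
  have ht2 : t * (2 * (L + 1)) ≤ 1 := by
    rw [← le_div_iff₀ (by positivity)]; exact min_le_right _ _
  -- The test value has the sign of `a`, and `t` is so small that `L * t < 1`: the linear term then
  -- beats the quadratic one.
  have := h (t * a) (by rwa [abs_mul, abs_of_pos ht0])
  have ha2 : 0 < a ^ 2 := by positivity
  have h2 : t * a ^ 2 * (1 - L * t) ≤ 0 := by nlinarith
  have h3 : 0 < 1 - L * t := by nlinarith
  have : 0 < t * a ^ 2 * (1 - L * t) := by positivity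
  linarith

/-- Finiteness of `φ` controls only `r⁻²`, but on the support of `σ` the factor `r⁻³` is at most
`δ⁻³`. -/
theorem integrable_cube_mul {r σ : 𝕋 → ℝ} {δ K : ℝ} (hr : Measurable r) (hσ : Measurable σ)
    (hδ : 0 < δ) (hK : ∀ h, |σ h| ≤ K) (hs : ∀ h, σ h ≠ 0 → δ ≤ r h) :
    Integrable fun h => σ h * (r h ^ 3)⁻¹ := by
  have hK0 : 0 ≤ K := (abs_nonneg _).trans (hK 0)
  refine Integrable.of_bound (by fun_prop) (K * (δ ^ 3)⁻¹) (.of_forall fun h => ?_)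
  by_cases h0 : σ h = 0
  · simp only [h0, zero_mul, norm_zero]; positivity
  · have := hs h h0
    have h1 : 0 < r h := hδ.trans_le this
    rw [Real.norm_eq_abs, abs_mul, abs_of_pos (a := (r h ^ 3)⁻¹) (by positivity)]
    gcongr
    exact hK h

/-- The first variation of `φ + ψ` in directions `v` for which `v_hh` is bounded and supported
where `η + c₀` is bounded below. -/
theorem first_variation (hc : 0 < c₀) (hC : 2 * c₀ ≤ C) (hξ : ξ ∈ B c₀ C u) {δ K : ℝ}
    (hδ : 0 < δ) {σ : 𝕋 → ℝ} (hσ : Measurable σ) (hK : ∀ h, |σ h| ≤ K)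
    (hs : ∀ h, σ h ≠ 0 → δ ≤ eta u h + c₀) (hv : IsPotential v S σ) :
    ⟪ξ, v⟫_ℝ + ∫ h, σ h * ((eta u h + c₀) ^ 3)⁻¹ = 0 := by
  have hK0 : 0 ≤ K := (abs_nonneg _).trans (hK 0)
  have hu := admissible_of_mem_B hc hC hξ
  have hfin := lintegral_Phi_lt_top hc hC hξ
  set r : 𝕋 → ℝ := fun h => eta u h + c₀ with hr_def
  have hr : Measurable r := (measurable_eta u).add_const c₀
  have hpos := ae_pos_of_lintegral_Phi hr hfin
  have hi1 := integrable_inv_sq hr hfin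
  have hi2 := integrable_cube_mul hr hσ hδ hK hs
  -- The bound on `ε` ensures `|ε σ| ≤ δ / 2`, as `Phi_add_le` requires, with `K + 1` to avoid
  -- dividing by zero; `L` is the quadratic constant of that estimate.
  refine eq_zero_of_forall_mul_le (ε₀ := δ / (2 * (K + 1))) (L := 8 * K ^ 2 / δ ^ 4)
    (by positivity) (by positivity) fun ε hε => ?_
  have hsmall (h : 𝕋) : |ε * σ h| ≤ δ / 2 := by
    rw [abs_mul]
    calc |ε| * |σ h| ≤ δ / (2 * (K + 1)) * (K + 1) := by
          gcongr
          linarith [hK h]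
      _ = δ / 2 := by field_simp
  have hpt (h : 𝕋) (hh : 0 < r h) : Phi (r h + ε * σ h) ≤ ENNReal.ofReal
      ((r h ^ 2)⁻¹ / 2 - ε * (σ h * (r h ^ 3)⁻¹) + 8 * K ^ 2 / δ ^ 4 * ε ^ 2) := by
    by_cases h0 : σ h = 0
    · rw [h0, mul_zero, add_zero, Phi_of_pos hh]
      refine ENNReal.ofReal_le_ofReal ?_
      have : 0 ≤ 8 * K ^ 2 / δ ^ 4 * ε ^ 2 := by positivity
      linarith
    · refine (Phi_add_le hδ (hs h h0) (hsmall h)).trans (ENNReal.ofReal_le_ofReal ?_)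
      have h1 : σ h ^ 2 ≤ K ^ 2 := sq_le_sq' (by linarith [(abs_le.1 (hK h)).1]) (abs_le.1 (hK h)).2
      have h2 : 8 * (ε * σ h) ^ 2 / δ ^ 4 ≤ 8 * K ^ 2 / δ ^ 4 * ε ^ 2 := by
        rw [mul_pow, show 8 * K ^ 2 / δ ^ 4 * ε ^ 2 = 8 * (ε ^ 2 * K ^ 2) / δ ^ 4 by ring]
        gcongr
      linarith
  have hpot := hv.smul ε
  have hnonneg : ∀ᵐ h, 0 ≤ eta u h + ε * σ h + c₀ := by
    filter_upwards [hpos] with h hh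
    by_cases h0 : σ h = 0
    · simpa [h0] using hh.le
    · have := hs h h0
      have := (abs_le.1 (hsmall h)).1
      simp only [hr_def] at *
      linarith
  have hadm : Admissible c₀ (u + ε • v) :=
    ⟨add_potential_mem_V hu.1 hpot, add_potential_nonneg hu.1 hpot hu.2 hnonneg⟩
  set J : ℝ := ∫ h, ((r h ^ 2)⁻¹ / 2 - ε * (σ h * (r h ^ 3)⁻¹) + 8 * K ^ 2 / δ ^ 4 * ε ^ 2) with hJ
  have hJi : Integrable fun h =>
      ((r h ^ 2)⁻¹ / 2 - ε * (σ h * (r h ^ 3)⁻¹) + 8 * K ^ 2 / δ ^ 4 * ε ^ 2) :=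
    (hi1.sub (hi2.const_mul ε)).add (integrable_const _)
  -- The Taylor bound dominates a value of `Phi`, which is never zero, so it cannot be negative.
  have hJnn : ∀ᵐ h, 0 ≤
      ((r h ^ 2)⁻¹ / 2 - ε * (σ h * (r h ^ 3)⁻¹) + 8 * K ^ 2 / δ ^ 4 * ε ^ 2) := by
    filter_upwards [hpos] with h hh
    by_contra hneg
    have h1 := hpt h hh
    rw [ENNReal.ofReal_of_nonpos (not_le.1 hneg).le, nonpos_iff_eq_zero] at h1
    rw [Phi] at h1
    split_ifs at h1 with h2
    · exact ENNReal.top_ne_zero h1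
    · rw [ENNReal.ofReal_eq_zero] at h1
      have : 0 < ((r h + ε * σ h) ^ 2)⁻¹ / 2 := by
        have := not_le.1 h2
        positivity
      linarith
  have hle : ∫⁻ h, Phi (eta (u + ε • v) h + c₀) ≤ ENNReal.ofReal J := by
    rw [hJ, ofReal_integral_eq_lintegral_ofReal hJi hJnn]
    refine lintegral_mono_ae ?_
    filter_upwards [hpos, eta_add_potential hu.1 hpot] with h hh he
    rw [he, show eta u h + ε * σ h + c₀ = r h + ε * σ h by simp only [hr_def]; ring]
    exact hpt h hh
  have hJ0 : 0 ≤ J := integral_nonneg_of_ae hJnn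
  have hI0 : 0 ≤ ∫ h, (r h ^ 2)⁻¹ / 2 := integral_nonneg fun h => by positivity
  have hB := hξ.2 _ hadm.1
  rw [hadm.total_eq hc.le hC, hu.total_eq hc.le hC, lintegral_Phi_eq hr hfin,
    EReal.coe_ennreal_ofReal, max_eq_left hI0, add_sub_cancel_left] at hB
  have hin : ⟪ξ, ε • v⟫_ℝ = ε * ⟪ξ, v⟫_ℝ := real_inner_smul_right (F := U) ξ v ε
  have hB2 := hB.trans (EReal.coe_ennreal_le_coe_ennreal_iff.2 hle)
  rw [EReal.coe_ennreal_ofReal, max_eq_left hJ0, ← EReal.coe_add, EReal.coe_le_coe_iff,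
    hin, hJ, integral_add (f := fun h => (r h ^ 2)⁻¹ / 2 - ε * (σ h * (r h ^ 3)⁻¹))
      (hi1.sub (hi2.const_mul ε)) (integrable_const _),
    integral_sub hi1 (hi2.const_mul ε), integral_const_mul, integral_const, measureReal_def,
    UnitAddCircle.measure_univ] at hB2
  simp only [ENNReal.toReal_one, one_smul] at hB2
  linarith

end FirstVariation

/-! ### The Euler–Lagrange equation, the energy and monotonicity. -/

section EulerLagrange

variable {c₀ C : ℝ} {u ξ : U}

/-- The Euler–Lagrange equation, where `η + c₀` is bounded below. -/
theorem flux_const_of_le (hc : 0 < c₀) (hC : 2 * c₀ ≤ C) (hξ : ξ ∈ B c₀ C u) {w : U} {R : 𝕋 → ℝ}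
    (hw : IsPotential w R ξ.1) {δ : ℝ} (hδ : 0 < δ) :
    ∃ m : ℝ, ∀ᵐ h, δ ≤ eta u h + c₀ → ((eta u h + c₀) ^ 3)⁻¹ + R h = m := by
  set r : 𝕋 → ℝ := fun h => eta u h + c₀ with hr_def
  have hr : Measurable r := (measurable_eta u).add_const c₀
  have hR := hw.continuous
  obtain ⟨L, hL⟩ := isCompact_univ.exists_bound_of_continuousOn hR.continuousOn
  set A : Set 𝕋 := {h | δ ≤ r h}
  have hA : MeasurableSet A := measurableSet_le measurable_const hr
  set P : 𝕋 → ℝ := fun h => (r h ^ 3)⁻¹ + R h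
  have hP : Measurable P := by fun_prop
  have hPb (h : 𝕋) (hh : h ∈ A) : |P h| ≤ (δ ^ 3)⁻¹ + L := by
    have h1 : δ ≤ r h := hh
    have h2 : 0 < r h := hδ.trans_le h1
    refine (abs_add_le _ _).trans (add_le_add ?_ (hL h (mem_univ h)))
    rw [abs_of_pos (by positivity)]
    gcongr
  have hPi : IntegrableOn P A := by
    refine Integrable.of_bound hP.aestronglyMeasurable ((δ ^ 3)⁻¹ + L) ?_
    exact (ae_restrict_iff' hA).2 (.of_forall hPb)
  -- Subtracting the average of `P` over `A` gives `σ` mean value zero, so that it is a second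
  -- derivative. If `A` is null, the quotient is `0` and `σ` vanishes a.e.
  set m : ℝ := (∫ h in A, P h) / volume.real A with hm
  set σ : 𝕋 → ℝ := A.indicator fun h => P h - m with hσ_def
  have hσ : Measurable σ := (hP.sub_const m).indicator hA
  have hσb (h : 𝕋) : |σ h| ≤ |(δ ^ 3)⁻¹ + L| + |m| := by
    by_cases hh : h ∈ A
    · rw [hσ_def, indicator_of_mem hh]
      exact (abs_sub _ _).trans (add_le_add_left ((hPb h hh).trans (le_abs_self _)) _)
    · rw [hσ_def, indicator_of_notMem hh, abs_zero]
      positivity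
  have hσs (h : 𝕋) (hh : σ h ≠ 0) : δ ≤ r h := by
    by_contra hn
    exact hh (indicator_of_notMem (show h ∉ A from hn) _)
  have hσi : Integrable σ := Integrable.of_bound hσ.aestronglyMeasurable _ (.of_forall hσb)
  have hσ0 : ∫ h, σ h = 0 := by
    rw [hσ_def, integral_indicator hA, integral_sub hPi (integrable_const m).integrableOn,
      setIntegral_const, smul_eq_mul, hm]
    by_cases h0 : volume.real A = 0
    · rw [Measure.restrict_eq_zero.2 ((measureReal_eq_zero_iff).1 h0)]
      simp [h0]
    · field_simp
      ring
  obtain ⟨v, S, hv⟩ := exists_isPotential hσi hσ0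
  have hvar := first_variation hc hC hξ hδ hσ hσb hσs hv
  have hin : ⟪ξ, v⟫_ℝ = ∫ h, σ h * R h := by
    rw [real_inner_comm, inner_eq_integral, integral_mul_congr hv.ae_eq]
    exact hv.integral_mul hw
  have hcube := integrable_cube_mul hr hσ hδ hσb hσs
  have hσR := integrable_mul_of_continuous hσi hR
  rw [hin, ← integral_add hσR hcube] at hvar
  -- On `A` one has `σ² = σ P - m σ`; the first term integrates to zero by the first variation, the
  -- second by the mean value of `σ`.
  have hsq : ∫ h, σ h ^ 2 = 0 := by
    have : ∀ h, σ h ^ 2 = (σ h * R h + σ h * (r h ^ 3)⁻¹) - m * σ h := by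
      intro h
      by_cases hh : h ∈ A
      · have : σ h = P h - m := indicator_of_mem hh _
        have h2 : P h = (r h ^ 3)⁻¹ + R h := rfl
        rw [this, h2]
        ring
      · have : σ h = 0 := indicator_of_notMem hh _
        rw [this]
        ring
    rw [integral_congr_ae (.of_forall this), integral_sub
      (f := fun h => σ h * R h + σ h * (r h ^ 3)⁻¹) (hσR.add hcube) (hσi.const_mul m),
      integral_const_mul, hσ0, mul_zero, sub_zero]
    exact hvar
  have hsqi : Integrable fun h => σ h ^ 2 := by
    refine Integrable.of_bound (hσ.pow_const 2).aestronglyMeasurable ((|(δ ^ 3)⁻¹ + L| + |m|) ^ 2)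
      (.of_forall fun h => ?_)
    rw [Real.norm_eq_abs, abs_pow]
    have := hσb h
    gcongr
  refine ⟨m, ?_⟩
  filter_upwards [(integral_eq_zero_iff_of_nonneg (fun h => sq_nonneg _) hsqi).1 hsq] with h hh hδh
  have h1 : σ h = 0 := by simpa using hh
  have h2 : σ h = P h - m := indicator_of_mem (show h ∈ A from hδh) _
  have h3 : P h = (r h ^ 3)⁻¹ + R h := rfl
  linarith

/-- Elements of the sub-differential are minus the second derivative of the flux. -/
theorem isFluxHH_of_mem_B (hc : 0 < c₀) (hC : 2 * c₀ ≤ C) (hξ : ξ ∈ B c₀ C u) :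
    IsFluxHH c₀ u (-ξ) := by
  have hu := admissible_of_mem_B hc hC hξ
  have hr : Measurable fun h => eta u h + c₀ := (measurable_eta u).add_const c₀
  have hpos := ae_pos_of_lintegral_Phi hr (lintegral_Phi_lt_top hc hC hξ)
  obtain ⟨w, R, hw⟩ := exists_isPotential (integrable_coe ξ) (integral_coe ξ)
  choose m hm using fun n : ℕ => flux_const_of_le hc hC hξ hw (δ := 1 / ((n : ℝ) + 1))
    (by positivity)
  have hgood : ∀ᵐ h, 0 < eta u h + c₀ ∧ ∀ n : ℕ, 1 / ((n : ℝ) + 1) ≤ eta u h + c₀ →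
      ((eta u h + c₀) ^ 3)⁻¹ + R h = m n := hpos.and (ae_all_iff.2 hm)
  obtain ⟨a, ha, ham⟩ := hgood.exists
  obtain ⟨c, hconst⟩ : ∃ c : ℝ, ∀ᵐ h, ((eta u h + c₀) ^ 3)⁻¹ = c - R h := by
    refine ⟨((eta u a + c₀) ^ 3)⁻¹ + R a, ?_⟩
    filter_upwards [hgood] with h hh
    -- A threshold below the values at both `a` and `h` places both points in one set where the sum
    -- is constant, so the constant does not depend on `n`.
    obtain ⟨n, hn⟩ := exists_nat_one_div_lt (lt_min ha hh.1)
    have h1 := ham n (hn.le.trans (min_le_left _ _))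
    have h2 := hh.2 n (hn.le.trans (min_le_right _ _))
    linarith
  have hR := hw.continuous
  refine ⟨hu.1, hpos, ?_, fun f hf => ?_⟩
  · exact (integrable_of_continuous (continuous_const.sub hR) volume).congr
      (hconst.mono fun h hh => hh.symm)
  · have hneg : (-ξ).1 =ᵐ[volume] fun h => -ξ.1 h := Lp.coeFn_neg ξ.1
    have hD := (hf.D 2).continuous
    have h0 : ∫ x, D 2 f x = 0 := by
      rw [D_two]
      exact (hf.D 1).isPrimitive.integral_eq_zero
    rw [integral_mul_congr hconst, integral_mul_congr hneg]
    simp only [sub_mul, neg_mul]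
    rw [integral_sub (f := fun x => c * D 2 f x) (g := fun x => R x * D 2 f x)
      (integrable_of_continuous (continuous_const.mul hD) volume)
      (integrable_of_continuous (hR.mul hD) volume), integral_const_mul, h0, mul_zero, zero_sub,
      hw.integral_mul_D hf, integral_neg]

theorem IsFluxHH.unique {g k : U} (hg : IsFluxHH c₀ u g) (hk : IsFluxHH c₀ u k) : g = k :=
  hg.2.2.unique hk.2.2

theorem IsFluxHH.energy_eq {g : U} (hg : IsFluxHH c₀ u g) :
    energy c₀ u = ENNReal.ofReal (1 / 2 * ‖g‖ ^ 2) := by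
  have hsq (k : U) : ∫ h, k.1 h ^ 2 = ‖k‖ ^ 2 := by
    rw [← real_inner_self_eq_norm_sq, inner_eq_integral]
    simp only [sq]
  refine le_antisymm (iInf₂_le_of_le g hg (by rw [hsq])) (le_iInf₂ fun k hk => ?_)
  rw [hk.unique hg, hsq]

/-- Monotonicity of the sub-differential. -/
theorem inner_sub_nonneg_of_mem_B (hc : 0 < c₀) (hC : 2 * c₀ ≤ C) {v ζ : U} (hξ : ξ ∈ B c₀ C u)
    (hζ : ζ ∈ B c₀ C v) : 0 ≤ ⟪ξ - ζ, u - v⟫_ℝ := by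
  have h1 := hξ.2 v hζ.1
  have h2 := hζ.2 u hξ.1
  have hbot (x : U) : total c₀ C x ≠ ⊥ := EReal.coe_ennreal_ne_bot _
  lift total c₀ C u to ℝ using ⟨(total_lt_top_of_mem_B hc hC hξ).ne, hbot u⟩ with a
  lift total c₀ C v to ℝ using ⟨(total_lt_top_of_mem_B hc hC hζ).ne, hbot v⟩ with b
  rw [← EReal.coe_add, EReal.coe_le_coe_iff] at h1 h2
  have h3 : ⟪ξ, v - u⟫_ℝ = -⟪ξ, u - v⟫_ℝ := by rw [← neg_sub u v, inner_neg_right]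
  rw [inner_sub_left]
  linarith

end EulerLagrange

/-! ### A differential inequality for norms of curves. -/

section Evolution

variable {F : Type*} [NormedAddCommGroup F] [InnerProductSpace ℝ F]

theorem deriv_norm_le {p : ℝ → F} {p' : F} {t M : ℝ} (hp : HasDerivAt p p' t) (hM : 0 ≤ M)
    (hd : DifferentiableAt ℝ (fun s => ‖p s‖) t) (h : ⟪p', p t⟫_ℝ ≤ M * ‖p t‖) :
    deriv (fun s => ‖p s‖) t ≤ M := by
  by_cases h0 : p t = 0
  · have : IsLocalMin (fun s => ‖p s‖) t :=
      .of_forall fun s => by simp [h0]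
    rw [this.deriv_eq_zero]
    exact hM
  · have h1 := hd.hasDerivAt.pow 2
    have h2 := hp.norm_sq
    have h3 := h1.unique h2
    have h4 : 0 < ‖p t‖ := norm_pos_iff.2 h0
    rw [real_inner_comm] at h
    simp only [Nat.cast_ofNat, Nat.add_one_sub_one, pow_one] at h3
    refine le_of_mul_le_mul_left ?_ h4
    linarith

/-- A differential inequality for the norm of an absolutely continuous curve. -/
theorem norm_primitive_le [CompleteSpace F] (x₀ : F) {f : ℝ → F} {T M L : ℝ} (hT : 0 ≤ T)
    (hM : 0 ≤ M) (hf : IntervalIntegrable f volume 0 T)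
    (hb : ∀ᵐ t, t ∈ Icc 0 T → ‖f t‖ ≤ L)
    (h : ∀ᵐ t, t ∈ Icc 0 T → ⟪f t, x₀ + ∫ s in (0 : ℝ)..t, f s⟫_ℝ ≤
      M * ‖x₀ + ∫ s in (0 : ℝ)..t, f s‖) :
    ‖x₀ + ∫ s in (0 : ℝ)..T, f s‖ ≤ ‖x₀‖ + M * T := by
  set p : ℝ → F := fun t => x₀ + ∫ s in (0 : ℝ)..t, f s with hp
  -- Lipschitz continuity makes the norm absolutely continuous, so it is the integral of its a.e.
  -- derivative.
  have hlip : LipschitzOnWith (Real.toNNReal L) (fun t => ‖p t‖) (uIcc 0 T) := by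
    refine LipschitzOnWith.of_dist_le_mul fun x hx y hy => ?_
    rw [uIcc_of_le hT] at hx hy
    have hi (z : ℝ) (hz : z ∈ Icc 0 T) : IntervalIntegrable f volume 0 z :=
      hf.mono_set (by rw [uIcc_of_le hT, uIcc_of_le hz.1]; exact Icc_subset_Icc_right hz.2)
    have hxy : p x - p y = ∫ s in y..x, f s := by
      simp only [hp, add_sub_add_left_eq_sub]
      exact intervalIntegral.integral_interval_sub_left (hi x hx) (hi y hy)
    refine (dist_norm_norm_le _ _).trans ?_
    rw [hxy, Real.dist_eq]
    refine intervalIntegral.norm_integral_le_of_norm_le_const_ae ?_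
    filter_upwards [hb] with s hs hm
    have hm' : s ∈ Icc 0 T := by
      have := uIoc_subset_uIcc hm
      exact (uIcc_subset_Icc hy hx) this
    exact (hs hm').trans (Real.le_coe_toNNReal L)
  have hac := hlip.absolutelyContinuousOnInterval
  have hint := hac.integral_deriv_eq_sub
  have hle : ∫ x in (0 : ℝ)..T, deriv (fun t => ‖p t‖) x ≤ ∫ _ in (0 : ℝ)..T, M := by
    refine intervalIntegral.integral_mono_ae_restrict hT hac.intervalIntegrable_deriv
      intervalIntegrable_const ?_
    refine (ae_restrict_iff' measurableSet_Icc).2 ?_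
    filter_upwards [hac.ae_differentiableAt, hf.ae_hasDerivAt_integral, h] with t h1 h2 h3 ht
    have ht' : t ∈ uIcc 0 T := by rwa [uIcc_of_le hT]
    exact deriv_norm_le ((h2 ht' 0 (by simp)).const_add x₀) hM (h1 ht') (h3 ht)
  rw [hint, intervalIntegral.integral_const] at hle
  have h0 : p 0 = x₀ := by simp [hp]
  rw [h0, smul_eq_mul] at hle
  linarith

end Evolution

/-! ### Speed bounds for variational inequality solutions. -/

variable {c₀ C T : ℝ} {w wt : ℝ → U}

theorem ae_time_iff {P : ℝ → Prop} : (∀ᵐ t ∂time T, P t) ↔ ∀ᵐ t, t ∈ Icc 0 T → P t :=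
  ae_restrict_iff' measurableSet_Icc

theorem IsVISolution.neg_mem_B (hw : IsVISolution c₀ C T w wt) :
    ∀ᵐ t, t ∈ Icc 0 T → -wt t ∈ B c₀ C (w t) := by
  obtain ⟨M, hM⟩ := hw.bounded
  rw [← ae_time_iff]
  filter_upwards [hM, hw.inequality] with t h1 h2
  refine ⟨h1.1, fun v hv => ?_⟩
  have h3 := h2 v hv
  rw [inner_neg_left, EReal.coe_neg, ← sub_eq_add_neg]
  exact EReal.sub_le_of_le_add' h3

theorem IsRegular.exists_bound (hw : IsRegular T w wt) :
    ∃ L : ℝ, ∀ᵐ t, t ∈ Icc 0 T → ‖wt t‖ ≤ L := by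
  have h := hw.deriv_memLp.2
  rw [eLpNorm_exponent_top] at h
  refine ⟨(eLpNormEssSup wt (time T)).toReal, ?_⟩
  rw [← ae_time_iff]
  filter_upwards [ae_le_eLpNormEssSup (f := wt) (μ := time T)] with t ht
  rw [← toReal_enorm]
  exact ENNReal.toReal_mono h.ne ht

theorem IsRegular.intervalIntegrable (hw : IsRegular T w wt) {a b : ℝ}
    (ha : a ∈ Icc 0 T) (hb : b ∈ Icc 0 T) : IntervalIntegrable wt volume a b := by
  have : IsFiniteMeasure (time T) := by unfold time; infer_instance
  have h : IntegrableOn wt (Icc 0 T) := hw.deriv_memLp.integrable (by simp)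
  exact (h.mono_set (uIcc_subset_Icc ha hb)).intervalIntegrable

theorem IsRegular.sub_eq (hw : IsRegular T w wt) {a b : ℝ} (ha : a ∈ Icc 0 T)
    (hb : b ∈ Icc 0 T) : w b - w a = ∫ s in a..b, wt s := by
  have h0 : (0 : ℝ) ∈ Icc 0 T := ⟨le_rfl, ha.1.trans ha.2⟩
  rw [hw.deriv_eq b hb, hw.deriv_eq a ha, add_sub_add_left_eq_sub]
  exact intervalIntegral.integral_interval_sub_left (hw.intervalIntegrable h0 hb)
    (hw.intervalIntegrable h0 ha)

/-- The solution leaves its initial datum with at most the speed given by an element of the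
sub-differential. -/
theorem IsVISolution.norm_sub_initial_le (hc : 0 < c₀) (hC : 2 * c₀ ≤ C)
    (hw : IsVISolution c₀ C T w wt) {ξ : U} (hξ : ξ ∈ B c₀ C (w 0)) {t : ℝ} (ht : t ∈ Icc 0 T) :
    ‖w t - w 0‖ ≤ ‖ξ‖ * t := by
  obtain ⟨L, hL⟩ := hw.exists_bound
  have h0 : (0 : ℝ) ∈ Icc 0 T := ⟨le_rfl, ht.1.trans ht.2⟩
  have := norm_primitive_le (0 : U) (f := wt) (M := ‖ξ‖) (L := L) ht.1 (norm_nonneg ξ)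
    (hw.intervalIntegrable h0 ht) (hL.mono fun s hs hm => hs ⟨hm.1, hm.2.trans ht.2⟩) ?_
  · rwa [zero_add, ← hw.sub_eq h0 ht, norm_zero, zero_add] at this
  · filter_upwards [hw.neg_mem_B] with s hs hm
    have hs' : s ∈ Icc 0 T := ⟨hm.1, hm.2.trans ht.2⟩
    rw [zero_add, ← hw.sub_eq h0 hs']
    -- Monotonicity between `-wt s` and `ξ` gives `⟪wt s, w s - w 0⟫ ≤ ⟪-ξ, w s - w 0⟫`, and
    -- Cauchy–Schwarz bounds the right side.
    have h1 := inner_sub_nonneg_of_mem_B hc hC (hs hs') hξ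
    have h2 := real_inner_le_norm (-ξ) (w s - w 0)
    rw [inner_sub_left, inner_neg_left] at h1
    rw [inner_neg_left, norm_neg] at h2
    linarith

/-- Translates of a solution approach each other. -/
theorem IsVISolution.norm_translate_le (hc : 0 < c₀) (hC : 2 * c₀ ≤ C)
    (hw : IsVISolution c₀ C T w wt) {s t : ℝ} (hs : 0 ≤ s) (ht : 0 ≤ t) (hst : t + s ≤ T) :
    ‖w (t + s) - w t‖ ≤ ‖w s - w 0‖ := by
  obtain ⟨L, hL⟩ := hw.exists_bound
  have hshift {P : ℝ → Prop} (hP : ∀ᵐ r, P r) : ∀ᵐ r, P (r + s) :=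
    (measurePreserving_add_right volume s).quasiMeasurePreserving.ae hP
  have h0 : (0 : ℝ) ∈ Icc 0 T := ⟨le_rfl, by linarith⟩
  have hsT : s ∈ Icc 0 T := ⟨hs, by linarith⟩
  have hi1 (r : ℝ) (hr : r ∈ Icc 0 t) : IntervalIntegrable (fun x => wt (x + s)) volume 0 r := by
    have := hw.intervalIntegrable hsT
      (show r + s ∈ Icc 0 T from ⟨by linarith [hr.1], by linarith [hr.2]⟩)
    simpa using this.comp_add_right s
  have hi2 (r : ℝ) (hr : r ∈ Icc 0 t) : IntervalIntegrable wt volume 0 r :=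
    hw.intervalIntegrable h0 ⟨hr.1, by linarith [hr.2]⟩
  have hp (r : ℝ) (hr : r ∈ Icc 0 t) :
      (w s - w 0) + ∫ x in (0 : ℝ)..r, (wt (x + s) - wt x) = w (r + s) - w r := by
    rw [intervalIntegral.integral_sub (hi1 r hr) (hi2 r hr),
      intervalIntegral.integral_comp_add_right, zero_add,
      ← hw.sub_eq hsT ⟨by linarith [hr.1], by linarith [hr.2]⟩,
      ← hw.sub_eq h0 ⟨hr.1, by linarith [hr.2]⟩]
    abel
  -- The choice `M = 0` expresses contraction: monotonicity makes the derivative of the squared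
  -- distance nonpositive.
  have := norm_primitive_le (w s - w 0) (f := fun x => wt (x + s) - wt x) (M := 0) (L := L + L)
    ht le_rfl ((hi1 t ⟨ht, le_rfl⟩).sub (hi2 t ⟨ht, le_rfl⟩)) ?_ ?_
  · rwa [hp t ⟨ht, le_rfl⟩, zero_mul, add_zero] at this
  · filter_upwards [hL, hshift hL] with r h1 h2 hr
    exact (norm_sub_le _ _).trans (add_le_add (h2 ⟨by linarith [hr.1], by linarith [hr.2]⟩)
      (h1 ⟨hr.1, by linarith [hr.2]⟩))
  · filter_upwards [hw.neg_mem_B, hshift hw.neg_mem_B] with r h1 h2 hr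
    rw [hp r hr]
    have h3 := inner_sub_nonneg_of_mem_B hc hC (h2 ⟨by linarith [hr.1], by linarith [hr.2]⟩)
      (h1 ⟨hr.1, by linarith [hr.2]⟩)
    have h4 : -wt (r + s) - -wt r = -(wt (r + s) - wt r) := by abel
    rw [h4, inner_neg_left] at h3
    linarith

/-- The two preceding estimates make `w` Lipschitz with constant `‖ξ‖`, and a Lipschitz constant
bounds the derivative wherever it exists. -/
theorem IsVISolution.norm_deriv_le (hc : 0 < c₀) (hC : 2 * c₀ ≤ C)
    (hw : IsVISolution c₀ C T w wt) {ξ : U} (hξ : ξ ∈ B c₀ C (w 0)) (hT : 0 < T) :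
    ∀ᵐ t, t ∈ Icc 0 T → ‖wt t‖ ≤ ‖ξ‖ := by
  have h0 : (0 : ℝ) ∈ Icc 0 T := ⟨le_rfl, hT.le⟩
  have hTm : T ∈ Icc 0 T := ⟨hT.le, le_rfl⟩
  have hlip (a b : ℝ) (ha : 0 ≤ a) (hab : a ≤ b) (hb : b ≤ T) : ‖w b - w a‖ ≤ ‖ξ‖ * (b - a) := by
    have h1 := hw.norm_translate_le hc hC (s := b - a) (t := a) (by linarith) ha (by linarith)
    rw [add_sub_cancel] at h1
    exact h1.trans (hw.norm_sub_initial_le hc hC hξ ⟨by linarith, by linarith⟩)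
  have hne0 : ∀ᵐ t : ℝ, t ≠ 0 := by simp [ae_iff, measure_singleton]
  have hneT : ∀ᵐ t : ℝ, t ≠ T := by simp [ae_iff, measure_singleton]
  filter_upwards [(hw.intervalIntegrable h0 hTm).ae_hasDerivAt_integral, hne0, hneT]
    with t hd h1 h2 ht
  have hd' := hd (by rwa [uIcc_of_le hT.le]) 0 (by simp)
  have hmem : Icc 0 T ∈ nhds t :=
    Icc_mem_nhds (lt_of_le_of_ne ht.1 (Ne.symm h1)) (lt_of_le_of_ne ht.2 h2)
  refine hd'.le_of_lip' (norm_nonneg ξ) ?_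
  filter_upwards [hmem] with s hs
  rw [← hw.sub_eq h0 hs, ← hw.sub_eq h0 ht, sub_sub_sub_cancel_right, Real.norm_eq_abs]
  rcases le_total t s with h | h
  · rw [abs_of_nonneg (by linarith)]
    exact hlip t s ht.1 h hs.2
  · rw [abs_of_nonpos (by linarith), norm_sub_rev, neg_sub]
    exact hlip s t hs.1 h ht.2

end ThinFilm

theorem theorem3p1 (c₀ C T : ℝ) (hc₀ : 0 < c₀) (hC : 2 * c₀ ≤ C) (hT : 0 < T)
    (w₀ : U) (hw₀ : w₀ ∈ domB c₀ C)
    (w wt : ℝ → U) (hw : IsVISolution c₀ C T w wt) (hinit : w 0 = w₀) :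
    IsStrongSolution c₀ T w wt := by
  obtain ⟨ξ, hξ⟩ := hw₀
  rw [← hinit] at hξ
  have hflux₀ := isFluxHH_of_mem_B hc₀ hC hξ
  have hflux : ∀ᵐ t ∂time T, IsFluxHH c₀ (w t) (wt t) := by
    rw [ae_time_iff]
    filter_upwards [hw.neg_mem_B] with t ht hm
    simpa using isFluxHH_of_mem_B hc₀ hC (ht hm)
  refine ⟨hw.toIsRegular, ⟨wt, hflux, .of_forall fun p => rfl, hw.deriv_memLp⟩, ?_, ?_⟩
  · rw [hflux₀.energy_eq]
    exact ENNReal.ofReal_lt_top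
  · filter_upwards [hflux, ae_time_iff.2 (hw.norm_deriv_le hc₀ hC hξ hT)] with t h1 h2
    -- The fluxes have second derivatives `wt t` and `-ξ`, so the energy inequality is the speed
    -- bound squared.
    rw [h1.energy_eq, hflux₀.energy_eq, norm_neg]
    gcongr
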